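/- **Lemma (Contraction implies E-$\delta$ISS).** Let $f:\mathbb R^n\times\mathbb R_{\ge 0}\to\mathbb R^n$ be continuously differentiable and let $M(x,t)$ be a continuously differentiable function on $\mathbb R^n\times\mathbb R_{\ge 0}$ with values in the symmetric positive definite $n\times n$ matrices (a time-varying Riemannian metric). Suppose that there are constants $0<\mu\le L<\infty$ and $\lambda>0$ such that for all $x\in\mathbb R^n$ and $t\ge 0$ $$\mu I\preccurlyeq M(x,t)\preccurlyeq L I$$ and $$\frac{\partial f}{\partial x}(x,t)^{\top}M(x,t)+M(x,t)\frac{\partial f}{\partial x}(x,t)+\dot M(x,t)\preccurlyeq-2\lambda M(x,t),$$ where $\dot M(x,t)=\frac{\partial M}{\partial t}(x,t)+\sum_{i=1}^n f_i(x,t)\frac{\partial M}{\partial x_i}(x,t)$ is the total derivative of $M$ along $\dot x=f(x,t)$. Then the system $\dot x=f(x,t)$ is $(\sqrt{L/\mu},\lambda,\sqrt{L/\mu})$-E-$\delta$ISS. Here, for $\beta,\rho,\gamma>0$, the system $\dot x=f(x,t)$ is called $(\beta,\rho,\gamma)$-exponentially incrementally input-to-state stable ($(\beta,\rho,\gamma)$-E-$\delta$ISS)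 if for every integrable input signal $u$ on an interval $[0,T]$ (which may depend on $x$ and $y$) and all (absolutely continuous) trajectories $x,y:[0,T]\to\mathbb R^n$ of $\dot x(t)=f(x(t),t)$ and $\dot y(t)=f(y(t),t)+u(t)$, with arbitrary initial conditions, one has for all $t\in[0,T]$ $$\|x(t)-y(t)\|_2\le\beta\,\|x(0)-y(0)\|_2\,e^{-\rho t}+\gamma\int_0^t e^{-\rho(t-s)}\|u(s)\|_2\,ds .$$ In particular, the bound holds for all $t\ge0$ when $x$ and $y$ exist for all time. -/

import Mathlib

open Set MeasureTheory

noncomputable section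

namespace ContractionISS

variable {n : ℕ}

/-- The time-space domain `ℝⁿ × [0, ∞)`. Maps of `(x, t)` are written as functions on `ℝⁿ × ℝ`, and
only their values for `t ≥ 0` are ever used. -/
def domain (n : ℕ) : Set (EuclideanSpace ℝ (Fin n) × ℝ) :=
  univ ×ˢ Ici 0

/-- A time-varying map is continuously differentiable, jointly in `(x, t)`, on `ℝⁿ × [0, ∞)`. -/
def IsC1 {F : Type*} [NormedAddCommGroup F] [NormedSpace ℝ F]
    (g : EuclideanSpace ℝ (Fin n) → ℝ → F) : Prop :=
  ContDiffOn ℝ 1 (fun p : EuclideanSpace ℝ (Fin n) × ℝ => g p.1 p.2) (domain n)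

/-- A time-varying `C¹` Riemannian metric on `ℝⁿ`: a symmetric positive definite `n × n` matrix
`M x t` (seen as an operator on Euclidean space) depending on `(x, t)` in a `C¹` way. -/
structure IsRiemannianMetric
    (M : EuclideanSpace ℝ (Fin n) → ℝ →
      (EuclideanSpace ℝ (Fin n) →L[ℝ] EuclideanSpace ℝ (Fin n))) : Prop where
  contDiff : IsC1 M
  selfAdjoint : ∀ x t, 0 ≤ t → IsSelfAdjoint (M x t)
  posDef : ∀ x t, 0 ≤ t → ∀ v, v ≠ 0 → 0 < inner ℝ v (M x t v)

/-- The Jacobian `∂f/∂x (x, t)`. -/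
def jacobian (f : EuclideanSpace ℝ (Fin n) → ℝ → EuclideanSpace ℝ (Fin n))
    (x : EuclideanSpace ℝ (Fin n)) (t : ℝ) :
    EuclideanSpace ℝ (Fin n) →L[ℝ] EuclideanSpace ℝ (Fin n) :=
  fderiv ℝ (fun z => f z t) x

/-- The total derivative of `M` along the flow of `f`,
`Ṁ(x, t) = ∂M/∂t (x, t) + ∑ i, fᵢ(x, t) ∂M/∂xᵢ (x, t)`,
i.e. the derivative of `M` on `ℝⁿ × [0, ∞)` in the direction `(f(x, t), 1)`. -/
def totalDeriv (f : EuclideanSpace ℝ (Fin n) → ℝ → EuclideanSpace ℝ (Fin n))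
    (M : EuclideanSpace ℝ (Fin n) → ℝ →
      (EuclideanSpace ℝ (Fin n) →L[ℝ] EuclideanSpace ℝ (Fin n)))
    (x : EuclideanSpace ℝ (Fin n)) (t : ℝ) :
    EuclideanSpace ℝ (Fin n) →L[ℝ] EuclideanSpace ℝ (Fin n) :=
  fderivWithin ℝ (fun p : EuclideanSpace ℝ (Fin n) × ℝ => M p.1 p.2) (domain n) (x, t) (f x t, 1)

/-- `f` is contracting in the metric `M` at rate `lam`:
`(∂f/∂x)ᵀ M + M (∂f/∂x) + Ṁ ≼ -2 lam M` at all `x ∈ ℝⁿ`, `t ≥ 0`. The order `≤` on operators is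
the Loewner order: `A ≤ B` means that `B - A` is symmetric positive semidefinite. -/
def IsContracting (f : EuclideanSpace ℝ (Fin n) → ℝ → EuclideanSpace ℝ (Fin n))
    (M : EuclideanSpace ℝ (Fin n) → ℝ →
      (EuclideanSpace ℝ (Fin n) →L[ℝ] EuclideanSpace ℝ (Fin n)))
    (lam : ℝ) : Prop :=
  ∀ x t, 0 ≤ t →
    ContinuousLinearMap.adjoint (jacobian f x t) ∘L M x t + M x t ∘L jacobian f x t
      + totalDeriv f M x t ≤ -(2 * lam) • M x t

/-- `y` is a trajectory on `[0, T]` of the perturbed system `ẏ(t) = f(y(t), t) + u(t)` with an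
integrable input `u`, i.e. an absolutely continuous solution of the equation in integral form.
With `u = 0` these are the trajectories of `ẋ = f(x, t)`. -/
structure IsTrajectory (f : EuclideanSpace ℝ (Fin n) → ℝ → EuclideanSpace ℝ (Fin n))
    (u : ℝ → EuclideanSpace ℝ (Fin n)) (T : ℝ) (y : ℝ → EuclideanSpace ℝ (Fin n)) : Prop where
  continuousOn : ContinuousOn y (Icc 0 T)
  input_integrable : IntervalIntegrable u volume 0 T
  integrable : IntervalIntegrable (fun s => f (y s) s + u s) volume 0 T
  eq_integral : ∀ t ∈ Icc 0 T, y t = y 0 + ∫ s in (0 : ℝ)..t, (f (y s) s + u s)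

/-- `(β, ρ, γ)`-exponential incremental input-to-state stability of `ẋ = f(x, t)`.
The input `u` and the trajectories `x`, `y` are quantified together, so that `u(t)` may depend in
any way, in particular causally, on `x` and `y`. The bound is asked on every interval `[0, T]` on
which the two trajectories exist, hence for all `t ≥ 0` when they are global. -/
def IsEdISS (β ρ γ : ℝ) (f : EuclideanSpace ℝ (Fin n) → ℝ → EuclideanSpace ℝ (Fin n)) : Prop :=
  0 < β ∧ 0 < ρ ∧ 0 < γ ∧
    ∀ (T : ℝ) (u x y : ℝ → EuclideanSpace ℝ (Fin n)),
      IsTrajectory f 0 T x → IsTrajectory f u T y →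
      ∀ t ∈ Icc 0 T,
        ‖x t - y t‖ ≤ β * ‖x 0 - y 0‖ * Real.exp (-ρ * t)
          + γ * ∫ s in (0 : ℝ)..t, Real.exp (-ρ * (t - s)) * ‖u s‖

end ContractionISS

end

/-!
The proof compares trajectories through the unperturbed flow, and needs neither geodesics of `M` nor
differentiability of the flow in the initial value. Put `K = √(L / μ)`.

Two solutions of `ż = f(z, t)` that stay close contract: for their difference `e`, the derivative of
`⟪e, M(z, t) e⟫` is the quadratic form of the contraction condition at `e`, up to the error of
linearizing `f` at `z`, which is uniformly `o(‖e‖²)` on compact sets. Hence `‖e‖` decays with constant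
`K` at every rate `κ < lam` (`exists_local_contraction`). Cutting the segment between two initial
values into short pieces and adding up removes the closeness assumption, with the same constant, and
also shows that solutions exist as long as a reference solution does
(`exists_isSolution_contracting`).

For the perturbed trajectory `y`, consider the unperturbed solutions starting from `y a` at time `a`.
Between `a` and `b = a + h` the trajectory `y` departs from such a solution by at most
`(1 + o(1)) ∫ ‖u‖` over `[a, b]` (`IsTrajectory.norm_sub_le`), and by contraction this departure
contributes at most `K exp (-κ (t - b)) (1 + o(1)) ∫ ‖u‖` at a later time `t`. Summing over the steps
from `a = 0`, where the solution is compared with `x`, to `a = T`, where it ends on `y`, gives the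
estimate up to factors (`norm_sub_le_of_rate_lt`) that disappear in the limit `κ → lam`. Working with
`f` alone between the steps matters: `M` is differentiated only along solutions of the unperturbed
system, so no term `∂M/∂x · u` appears.
-/

namespace ContractionISS

variable {n : ℕ}

/-! ### Time-varying `C¹` maps -/

lemma uniqueDiffOn_domain : UniqueDiffOn ℝ (domain n) :=
  uniqueDiffOn_univ.prod (uniqueDiffOn_Ici 0)

section C1

variable {F : Type*} [NormedAddCommGroup F] [NormedSpace ℝ F]
  {g : EuclideanSpace ℝ (Fin n) → ℝ → F}

lemma IsC1.hasFDerivAt (hg : IsC1 g) (x : EuclideanSpace ℝ (Fin n)) {t : ℝ} (ht : 0 ≤ t) :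
    HasFDerivAt (fun z => g z t)
      ((fderivWithin ℝ (fun p : EuclideanSpace ℝ (Fin n) × ℝ => g p.1 p.2) (domain n) (x, t)).comp
        (ContinuousLinearMap.inl ℝ _ ℝ)) x := by
  have hmem : (x, t) ∈ domain n := ⟨mem_univ _, ht⟩
  have h1 := ((hg.differentiableOn one_ne_zero) (x, t) hmem).hasFDerivWithinAt
  have h2 : HasFDerivWithinAt (fun z : EuclideanSpace ℝ (Fin n) => (z, t))
      (ContinuousLinearMap.inl ℝ _ ℝ) univ x := (hasFDerivAt_prodMk_left x t).hasFDerivWithinAt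
  have hmaps : MapsTo (fun z : EuclideanSpace ℝ (Fin n) => (z, t)) univ (domain n) :=
    fun z _ => ⟨mem_univ _, ht⟩
  have h3 := h1.comp x h2 hmaps
  exact hasFDerivWithinAt_univ.1 h3

lemma IsC1.continuousOn_fderiv (hg : IsC1 g) :
    ContinuousOn (fun p : EuclideanSpace ℝ (Fin n) × ℝ => fderiv ℝ (fun z => g z p.2) p.1)
      (domain n) := by
  have h1 := hg.continuousOn_fderivWithin uniqueDiffOn_domain le_rfl
  have h2 : ContinuousOn (fun p : EuclideanSpace ℝ (Fin n) × ℝ =>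
      (fderivWithin ℝ (fun p : EuclideanSpace ℝ (Fin n) × ℝ => g p.1 p.2) (domain n) p).comp
        (ContinuousLinearMap.inl ℝ _ ℝ)) (domain n) := h1.clm_comp continuousOn_const
  exact h2.congr fun p hp => (hg.hasFDerivAt p.1 hp.2).fderiv

lemma isCompact_slab (R T : ℝ) :
    IsCompact (Metric.closedBall (0 : EuclideanSpace ℝ (Fin n)) R ×ˢ Icc 0 T) :=
  (isCompact_closedBall _ _).prod isCompact_Icc

lemma slab_subset_domain (R T : ℝ) :
    Metric.closedBall (0 : EuclideanSpace ℝ (Fin n)) R ×ˢ Icc 0 T ⊆ domain n :=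
  fun _ hp => ⟨mem_univ _, hp.2.1⟩

lemma IsC1.exists_lipschitzOnWith (hg : IsC1 g) (R T : ℝ) :
    ∃ K : NNReal, ∀ t ∈ Icc 0 T,
      LipschitzOnWith K (fun z => g z t) (Metric.closedBall 0 R) := by
  obtain ⟨C, hC⟩ := (isCompact_slab R T).exists_bound_of_continuousOn
    (hg.continuousOn_fderiv.mono (slab_subset_domain (n := n) R T))
  refine ⟨C.toNNReal, fun t ht => ?_⟩
  refine (convex_closedBall _ _).lipschitzOnWith_of_nnnorm_hasFDerivWithin_le
    (fun x _ => ((hg.hasFDerivAt x ht.1).differentiableAt.hasFDerivAt).hasFDerivWithinAt) ?_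
  intro x hx
  rw [← NNReal.coe_le_coe, coe_nnnorm]
  exact (hC (x, t) ⟨hx, ht⟩).trans (Real.le_coe_toNNReal C)

/-- The first-order expansion of `z ↦ g z t` is uniform on compact sets. -/
lemma IsC1.exists_uniform_linearization (hg : IsC1 g) (R T : ℝ) {ε : ℝ} (hε : 0 < ε) :
    ∃ δ > 0, ∀ t ∈ Icc 0 T, ∀ z ∈ Metric.closedBall (0 : EuclideanSpace ℝ (Fin n)) R, ∀ w,
      ‖w - z‖ ≤ δ → ‖g w t - g z t - fderiv ℝ (fun v => g v t) z (w - z)‖ ≤ ε * ‖w - z‖ := by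
  have huc := (isCompact_slab (R + 1) T).uniformContinuousOn_of_continuous
    (hg.continuousOn_fderiv.mono (slab_subset_domain (n := n) (R + 1) T))
  obtain ⟨δ, hδ, h⟩ := Metric.uniformContinuousOn_iff.1 huc ε hε
  refine ⟨min (δ / 2) 1, by positivity, fun t ht z hz w hw => ?_⟩
  set r := min (δ / 2) 1
  have hr0 : 0 ≤ r := by positivity
  have hr1 : r ≤ 1 := min_le_right _ _
  have hr2 : r < δ := (min_le_left _ _).trans_lt (by linarith)
  have hball : ∀ v ∈ Metric.closedBall z r, v ∈ Metric.closedBall 0 (R + 1) := fun v hv => by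
    rw [Metric.mem_closedBall] at *
    linarith [dist_triangle v z 0]
  have hzr : z ∈ Metric.closedBall z r := Metric.mem_closedBall_self hr0
  refine (convex_closedBall z r).norm_image_sub_le_of_norm_hasFDerivWithin_le'
    (f' := fun v => fderiv ℝ (fun v => g v t) v)
    (fun x _ => ((hg.hasFDerivAt x ht.1).differentiableAt.hasFDerivAt).hasFDerivWithinAt) ?_
    hzr (by rwa [mem_closedBall_iff_norm])
  intro v hv
  rw [← dist_eq_norm]
  refine (h (v, t) ⟨hball v hv, ht⟩ (z, t) ⟨hball z hzr, ht⟩ ?_).le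
  rw [Prod.dist_eq, dist_self, max_eq_left dist_nonneg]
  exact (Metric.mem_closedBall.1 hv).trans_lt hr2

/-- Multiplication by a bump function in `x` makes a time-varying `C¹` map bounded without changing
it on a given ball. -/
lemma IsC1.exists_bounded_truncation (hg : IsC1 g) (R T : ℝ) :
    ∃ G : EuclideanSpace ℝ (Fin n) → ℝ → F, IsC1 G ∧
      (∀ x ∈ Metric.closedBall 0 R, ∀ t, G x t = g x t) ∧
      ∃ C, 0 ≤ C ∧ ∀ t ∈ Icc 0 T, ∀ x, ‖G x t‖ ≤ C := by
  let χ : ContDiffBump (0 : EuclideanSpace ℝ (Fin n)) :=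
    ⟨max R 1, max R 1 + 1, by positivity, by linarith⟩
  obtain ⟨C, hC⟩ := (isCompact_slab (max R 1 + 1) T).exists_bound_of_continuousOn
    (hg.continuousOn.mono (slab_subset_domain (n := n) (max R 1 + 1) T))
  refine ⟨fun x t => χ x • g x t, ?_, ?_, max C 0, le_max_right _ _, ?_⟩
  · exact ((χ.contDiff (n := 1)).comp contDiff_fst).contDiffOn.smul hg
  · intro x hx t
    have : χ x = 1 :=
      χ.one_of_mem_closedBall (Metric.closedBall_subset_closedBall (le_max_left _ _) hx)
    simp [this]
  · intro t ht x
    by_cases hx : x ∈ Metric.closedBall 0 (max R 1 + 1)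
    · rw [norm_smul, Real.norm_of_nonneg χ.nonneg]
      have h1 := hC (x, t) ⟨hx, ht⟩
      have h2 : χ x ≤ 1 := χ.le_one
      calc χ x * ‖g x t‖ ≤ 1 * ‖g x t‖ := by gcongr
        _ ≤ max C 0 := by rw [one_mul]; exact h1.trans (le_max_left _ _)
    · have : χ x = 0 := χ.zero_of_le_dist (by
        rw [Metric.mem_closedBall, not_le] at hx; exact hx.le)
      simp [this]

end C1

/-! ### Classical solutions -/

/-- `z` is a classical solution of `ż = f(z, t)` on `[s, T]`, with one-sided derivatives at the
endpoints. -/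
def IsSolution (f : EuclideanSpace ℝ (Fin n) → ℝ → EuclideanSpace ℝ (Fin n)) (s T : ℝ)
    (z : ℝ → EuclideanSpace ℝ (Fin n)) : Prop :=
  ∀ t ∈ Icc s T, HasDerivWithinAt z (f (z t) t) (Icc s T) t

section Solution

variable {f : EuclideanSpace ℝ (Fin n) → ℝ → EuclideanSpace ℝ (Fin n)} {s T : ℝ}
  {z w : ℝ → EuclideanSpace ℝ (Fin n)}

lemma IsSolution.continuousOn (hz : IsSolution f s T z) : ContinuousOn z (Icc s T) :=
  fun t ht => (hz t ht).continuousWithinAt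

lemma IsSolution.mono (hz : IsSolution f s T z) {s' : ℝ} (hs : s ≤ s') : IsSolution f s' T z :=
  fun t ht => (hz t ⟨hs.trans ht.1, ht.2⟩).mono (Icc_subset_Icc_left hs)

lemma continuousOn_comp_curve {F : Type*} [NormedAddCommGroup F] [NormedSpace ℝ F]
    {g : EuclideanSpace ℝ (Fin n) → ℝ → F} (hg : IsC1 g) (hs : 0 ≤ s)
    (hz : ContinuousOn z (Icc s T)) : ContinuousOn (fun t => g (z t) t) (Icc s T) :=
  ContDiffOn.continuousOn hg |>.comp (hz.prodMk continuousOn_id)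
    fun _ ht => ⟨mem_univ _, hs.trans ht.1⟩

lemma IsSolution.eq_integral (hf : IsC1 f) (hs : 0 ≤ s) (hz : IsSolution f s T z) {t : ℝ}
    (ht : t ∈ Icc s T) : z t = z s + ∫ r in s..t, f (z r) r := by
  have hsub : Icc s t ⊆ Icc s T := Icc_subset_Icc_right ht.2
  have h := intervalIntegral.integral_eq_sub_of_hasDerivAt_of_le ht.1
    (hz.continuousOn.mono hsub)
    (fun r hr => (hz r ⟨hr.1.le, hr.2.le.trans ht.2⟩).hasDerivAt
      (Icc_mem_nhds hr.1 (hr.2.trans_le ht.2)))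
    ((continuousOn_comp_curve hf hs hz.continuousOn).mono hsub |>.intervalIntegrable_of_Icc ht.1)
  rw [h]; abel

/-- A trajectory without input is a classical solution. -/
lemma IsTrajectory.isSolution (hf : IsC1 f) {x : ℝ → EuclideanSpace ℝ (Fin n)}
    (hx : IsTrajectory f 0 T x) : IsSolution f 0 T x := by
  intro t ht
  have : Fact (t ∈ Icc 0 T) := ⟨ht⟩
  have hc := continuousOn_comp_curve hf le_rfl hx.continuousOn
  have h := intervalIntegral.integral_hasDerivWithinAt_right (a := 0) (b := t)
    (s := Icc 0 T) (t := Icc 0 T) (f := fun r => f (x r) r)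
  have h' := h (hc.mono (Icc_subset_Icc_right ht.2) |>.intervalIntegrable_of_Icc ht.1)
    (hc.stronglyMeasurableAtFilter_nhdsWithin measurableSet_Icc t) (hc t ht)
  refine (h'.const_add (x 0)).congr (fun r hr => ?_) ?_
  · simpa using hx.eq_integral r hr
  · simpa using hx.eq_integral t ht

/-- Global existence for a bounded `C¹` vector field. -/
lemma exists_isSolution_of_bounded (hf : IsC1 f) {C : ℝ} (hC0 : 0 ≤ C)
    (hC : ∀ t ∈ Icc 0 T, ∀ x, ‖f x t‖ ≤ C) (hs : 0 ≤ s) (hsT : s ≤ T)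
    (p : EuclideanSpace ℝ (Fin n)) : ∃ z, z s = p ∧ IsSolution f s T z := by
  -- A speed bound `C` keeps solutions within `C * T` of `p`, so the field need only be Lipschitz
  -- on a large ball.
  obtain ⟨K, hK⟩ := hf.exists_lipschitzOnWith (‖p‖ + C * T) T
  have hT : 0 ≤ T := hs.trans hsT
  have hPL : IsPicardLindelof (fun t x => f x t) (tmin := s) (tmax := T)
      ⟨s, le_rfl, hsT⟩ p (C * T).toNNReal 0 C.toNNReal K := by
    refine ⟨fun t ht => ?_, fun x _ => ?_, fun t ht x _ => ?_, ?_⟩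
    · refine (hK t ⟨hs.trans ht.1, ht.2⟩).mono fun x hx => ?_
      rw [mem_closedBall_iff_norm, Real.coe_toNNReal _ (by positivity)] at hx
      rw [mem_closedBall_zero_iff]
      linarith [norm_le_norm_add_norm_sub' x p]
    · exact continuousOn_comp_curve hf hs continuousOn_const
    · rw [Real.coe_toNNReal _ hC0]
      exact hC t ⟨hs.trans ht.1, ht.2⟩ x
    · rw [Real.coe_toNNReal _ hC0, Real.coe_toNNReal _ (by positivity)]
      simp only [sub_self, NNReal.coe_zero, sub_zero]
      rw [max_eq_left (by linarith)]
      gcongr; linarith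
  obtain ⟨z, hz, hz'⟩ := hPL.exists_eq_forall_mem_Icc_hasDerivWithinAt₀
  exact ⟨z, hz, hz'⟩

lemma IsSolution.norm_sub_le (hs : 0 ≤ s) {R : ℝ} {K : NNReal}
    (hK : ∀ t ∈ Icc 0 T, LipschitzOnWith K (fun z => f z t) (Metric.closedBall 0 R))
    (hz : IsSolution f s T z) (hw : IsSolution f s T w)
    (hzR : ∀ t ∈ Icc s T, ‖z t‖ ≤ R) (hwR : ∀ t ∈ Icc s T, ‖w t‖ ≤ R) :
    ∀ t ∈ Icc s T, ‖w t - z t‖ ≤ ‖w s - z s‖ * Real.exp (K * (t - s)) := by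
  intro t ht
  have key : ∀ v : ℝ → EuclideanSpace ℝ (Fin n), IsSolution f s T v →
      ∀ t ∈ Ico s T, HasDerivWithinAt v (f (v t) t) (Ici t) t := fun v hv t ht =>
    ((hv t ⟨ht.1, ht.2.le⟩).mono (Icc_subset_Icc_left ht.1)).mono_of_mem_nhdsWithin
      (Icc_mem_nhdsGE ht.2)
  have := dist_le_of_trajectories_ODE_of_mem (v := fun t x => f x t) (K := K)
    (s := fun _ => Metric.closedBall 0 R)
    (fun t ht => hK t ⟨hs.trans ht.1, ht.2.le⟩) hw.continuousOn (key w hw)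
    (fun t ht => mem_closedBall_zero_iff.2 (hwR t ⟨ht.1, ht.2.le⟩)) hz.continuousOn (key z hz)
    (fun t ht => mem_closedBall_zero_iff.2 (hzR t ⟨ht.1, ht.2.le⟩)) le_rfl t ht
  simpa only [dist_eq_norm] using this

end Solution

/-! ### Contraction of nearby solutions -/

section Contraction

variable {f : EuclideanSpace ℝ (Fin n) → ℝ → EuclideanSpace ℝ (Fin n)}
  {M : EuclideanSpace ℝ (Fin n) → ℝ →
      (EuclideanSpace ℝ (Fin n) →L[ℝ] EuclideanSpace ℝ (Fin n))} {μ L lam κ T : ℝ}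

lemma inner_apply_le_of_le {E : Type*} [NormedAddCommGroup E] [InnerProductSpace ℝ E]
    {A B : E →L[ℝ] E} (h : A ≤ B) (v : E) : inner ℝ v (A v) ≤ inner ℝ v (B v) := by
  have := (ContinuousLinearMap.le_def A B).1 h |>.inner_nonneg_right v
  rw [sub_apply, inner_sub_right] at this
  linarith

lemma IsContracting.inner_le (hcontr : IsContracting f M lam)
    (x v : EuclideanSpace ℝ (Fin n)) {t : ℝ} (ht : 0 ≤ t) :
    inner ℝ (jacobian f x t v) (M x t v) + inner ℝ v (M x t (jacobian f x t v))
      + inner ℝ v (totalDeriv f M x t v) ≤ -(2 * lam) * inner ℝ v (M x t v) := by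
  have := inner_apply_le_of_le (hcontr x t ht) v
  simpa only [add_apply, ContinuousLinearMap.comp_apply, inner_add_right,
    ContinuousLinearMap.adjoint_inner_right, smul_apply, inner_smul_right]
    using this

lemma hasDerivWithinAt_metric_along_solution (hM : IsC1 M) {s : ℝ} (hs : 0 ≤ s)
    {z : ℝ → EuclideanSpace ℝ (Fin n)} (hz : IsSolution f s T z) {t : ℝ} (ht : t ∈ Icc s T) :
    HasDerivWithinAt (fun r => M (z r) r) (totalDeriv f M (z t) t) (Icc s T) t := by
  have hmaps : MapsTo (fun r => (z r, r)) (Icc s T) (domain n) :=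
    fun r hr => ⟨mem_univ _, hs.trans hr.1⟩
  have h1 := ((hM.differentiableOn one_ne_zero) (z t, t) (hmaps ht)).hasFDerivWithinAt
  have h2 : HasDerivWithinAt (fun r => (z r, r)) (f (z t) t, (1 : ℝ)) (Icc s T) t :=
    (hz t ht).prodMk (hasDerivWithinAt_id t _)
  exact HasFDerivWithinAt.comp_hasDerivWithinAt (f := fun r => (z r, r)) t h1 h2 hmaps

/-- Sufficiently close solutions contract at any rate below `lam`: the squared distance
`⟪e, M(z, t) e⟫` with `e = w - z` decays because `f(w, t) - f(z, t)` is the Jacobian applied to `e`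
up to an error of size `o(‖e‖)`, uniformly on compact sets. -/
lemma exists_local_contraction (hμ : 0 < μ) (hμL : μ ≤ L)
    (hf : IsC1 f) (hM : IsC1 M)
    (hbound : ∀ x t, 0 ≤ t →
      μ • ContinuousLinearMap.id ℝ (EuclideanSpace ℝ (Fin n)) ≤ M x t ∧
      M x t ≤ L • ContinuousLinearMap.id ℝ (EuclideanSpace ℝ (Fin n)))
    (hcontr : IsContracting f M lam) (hκ : κ < lam) (R T : ℝ) :
    ∃ δ > 0, ∀ s, 0 ≤ s → ∀ z w, IsSolution f s T z → IsSolution f s T w →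
      (∀ t ∈ Icc s T, ‖z t‖ ≤ R) → (∀ t ∈ Icc s T, ‖w t - z t‖ ≤ δ) →
      ∀ t ∈ Icc s T,
        ‖w t - z t‖ ≤ Real.sqrt (L / μ) * Real.exp (-κ * (t - s)) * ‖w s - z s‖ := by
  obtain ⟨C, hC⟩ := (isCompact_slab R T).exists_bound_of_continuousOn
    ((ContDiffOn.continuousOn hM).mono (slab_subset_domain (n := n) R T))
  have hC1 : 0 < max C 1 := by positivity
  -- The linearization error is chosen to cost at most `2 * (lam - κ) * ⟪e, M e⟫`.
  obtain ⟨δ, hδ, hlin⟩ := hf.exists_uniform_linearization R T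
    (ε := (lam - κ) * μ / max C 1) (div_pos (mul_pos (by linarith) hμ) hC1)
  have hlow : ∀ x t, 0 ≤ t → ∀ v, μ * ‖v‖ ^ 2 ≤ inner ℝ v (M x t v) := fun x t ht v => by
    simpa [inner_smul_right] using inner_apply_le_of_le (hbound x t ht).1 v
  have hup : ∀ x t, 0 ≤ t → ∀ v, inner ℝ v (M x t v) ≤ L * ‖v‖ ^ 2 := fun x t ht v => by
    simpa [inner_smul_right] using inner_apply_le_of_le (hbound x t ht).2 v
  refine ⟨δ, hδ, fun s hs z w hz hw hzR hzw t ht => ?_⟩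
  set e : ℝ → EuclideanSpace ℝ (Fin n) := fun r => w r - z r with he
  set W : ℝ → ℝ := fun r => inner ℝ (e r) (M (z r) r (e r)) with hW
  have hderiv : ∀ r ∈ Icc s T, ∃ W', HasDerivWithinAt W W' (Icc s T) r ∧ W' ≤ -(2 * κ) * W r := by
    intro r hr
    have hr0 : 0 ≤ r := hs.trans hr.1
    have he' : HasDerivWithinAt e (f (w r) r - f (z r) r) (Icc s T) r := (hw r hr).sub (hz r hr)
    have hMe := (hasDerivWithinAt_metric_along_solution hM hs hz hr).clm_apply he'
    refine ⟨_, he'.inner ℝ hMe, ?_⟩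
    have hzr : z r ∈ Metric.closedBall 0 R := mem_closedBall_zero_iff.2 (hzR r hr)
    have hρ := hlin r ⟨hr0, hr.2⟩ (z r) hzr (w r) (hzw r hr)
    have hn := (hC (z r, r) ⟨hzr, hr0, hr.2⟩).trans (le_max_left C 1)
    have hJ := hcontr.inner_le (z r) (e r) hr0
    have hl := hlow (z r) r hr0 (e r)
    have hsplit : f (w r) r - f (z r) r = jacobian f (z r) r (e r) +
        (f (w r) r - f (z r) r - fderiv ℝ (fun v => f v r) (z r) (w r - z r)) := by
      simp [jacobian, he]
    generalize (f (w r) r - f (z r) r - fderiv ℝ (fun v => f v r) (z r) (w r - z r)) = ρ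
      at hρ hsplit
    change ‖ρ‖ ≤ _ * ‖e r‖ at hρ
    have hA : ‖ρ‖ * (max C 1 * ‖e r‖) ≤ (lam - κ) * inner ℝ (e r) (M (z r) r (e r)) := by
      calc ‖ρ‖ * (max C 1 * ‖e r‖)
          ≤ ((lam - κ) * μ / max C 1 * ‖e r‖) * (max C 1 * ‖e r‖) := by gcongr
        _ = (lam - κ) * (μ * ‖e r‖ ^ 2) := by field_simp
        _ ≤ _ := by
          have : 0 ≤ lam - κ := by linarith
          gcongr
    have hB1 : inner ℝ ρ (M (z r) r (e r)) ≤ ‖ρ‖ * (max C 1 * ‖e r‖) :=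
      (real_inner_le_norm _ _).trans (by
        gcongr; exact (M (z r) r).le_of_opNorm_le hn _)
    have hB2 : inner ℝ (e r) (M (z r) r ρ) ≤ ‖ρ‖ * (max C 1 * ‖e r‖) :=
      (real_inner_le_norm _ _).trans (by
        have := (M (z r) r).le_of_opNorm_le hn ρ
        calc ‖e r‖ * ‖M (z r) r ρ‖ ≤ ‖e r‖ * (max C 1 * ‖ρ‖) := by gcongr
          _ = _ := by ring)
    rw [hsplit]
    simp only [hW, inner_add_right, inner_add_left, map_add]
    linarith
  choose! W' hW' hW'le using hderiv
  have hexp : ∀ r, HasDerivAt (fun r => Real.exp (2 * κ * r)) (Real.exp (2 * κ * r) * (2 * κ)) r :=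
    fun r => by simpa using ((hasDerivAt_id r).const_mul (2 * κ)).exp
  have hanti : AntitoneOn (fun r => Real.exp (2 * κ * r) * W r) (Icc s T) := by
    refine antitoneOn_of_hasDerivWithinAt_nonpos (convex_Icc s T)
      (f' := fun r => Real.exp (2 * κ * r) * (2 * κ) * W r + Real.exp (2 * κ * r) * W' r)
      (fun r hr => ((hexp r).hasDerivWithinAt.mul (hW' r hr)).continuousWithinAt)
      (fun r hr => (((hexp r).hasDerivWithinAt.mul (hW' r (interior_subset hr))).mono
        interior_subset)) fun r hr => ?_
    have := mul_le_mul_of_nonneg_left (hW'le r (interior_subset hr)) (Real.exp_pos (2 * κ * r)).le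
    linarith
  have hsT : s ≤ T := ht.1.trans ht.2
  have hWt := hanti (left_mem_Icc.2 hsT) ht ht.1
  have hsq : ‖e t‖ ^ 2 ≤ (Real.sqrt (L / μ) * Real.exp (-κ * (t - s)) * ‖e s‖) ^ 2 := by
    have h1 : Real.exp (2 * κ * t) * (μ * ‖e t‖ ^ 2) ≤ Real.exp (2 * κ * s) * (L * ‖e s‖ ^ 2) :=
      calc _ ≤ Real.exp (2 * κ * t) * W t := by gcongr; exact hlow _ _ (hs.trans ht.1) _
        _ ≤ Real.exp (2 * κ * s) * W s := hWt
        _ ≤ _ := by gcongr; exact hup _ _ hs _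
    have h2 : Real.exp (-κ * (t - s)) ^ 2 * Real.exp (2 * κ * t) = Real.exp (2 * κ * s) := by
      rw [← Real.exp_nat_mul, ← Real.exp_add]; congr 1; push_cast; ring
    rw [mul_pow, mul_pow, Real.sq_sqrt (div_nonneg (hμ.le.trans hμL) hμ.le)]
    refine le_of_mul_le_mul_left ?_ (mul_pos (Real.exp_pos (2 * κ * t)) hμ)
    calc _ ≤ Real.exp (2 * κ * s) * (L * ‖e s‖ ^ 2) := by linarith
      _ = _ := by rw [← h2]; field_simp
  exact le_of_sq_le_sq hsq (by positivity)

end Contraction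

/-! ### Contraction of arbitrary solutions -/

/-- Induction along `[0, T]` in steps of length at most `h`. -/
lemma induction_small_steps {P : ℝ → Prop} {T h : ℝ} (hT : 0 ≤ T) (hh : 0 < h) (h0 : P 0)
    (hstep : ∀ a b, 0 ≤ a → a ≤ b → b ≤ T → b - a ≤ h → P a → P b) : P T := by
  obtain ⟨N, hN⟩ := exists_nat_gt (T / h)
  have hN0 : (0 : ℝ) < N := (div_nonneg hT hh.le).trans_lt hN
  have key : ∀ k : ℕ, k ≤ N → P (T * (k / N)) := by
    intro k
    induction k with
    | zero => intro _; simpa using h0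
    | succ k ih =>
      intro hk
      have hk' : ((k + 1 : ℕ) : ℝ) / N ≤ 1 := (div_le_one hN0).2 (by exact_mod_cast hk)
      refine hstep _ _ (by positivity) ?_ (by nlinarith) ?_ (ih (by omega))
      · gcongr; omega
      · have : T * (((k + 1 : ℕ) : ℝ) / N) - T * (k / N) = T / N := by push_cast; ring
        rw [this, div_le_iff₀ hN0, mul_comm]
        exact ((div_lt_iff₀ hh).1 hN).le
  simpa [hN0.ne'] using key N le_rfl

section Contraction

variable {f : EuclideanSpace ℝ (Fin n) → ℝ → EuclideanSpace ℝ (Fin n)}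
  {M : EuclideanSpace ℝ (Fin n) → ℝ →
      (EuclideanSpace ℝ (Fin n) →L[ℝ] EuclideanSpace ℝ (Fin n))} {μ L lam κ s T : ℝ}

/-- If one solution exists on `[s, T]`, then so does a solution from every other initial value, and
the two approach each other exponentially. The segment between the initial values is traversed in
small steps. The solution of each step is obtained from a globally bounded truncation of `f`; local
contraction keeps it in the region where the truncation agrees with `f`. -/
lemma exists_isSolution_contracting (hμ : 0 < μ) (hμL : μ ≤ L)
    (hf : IsC1 f) (hM : IsC1 M)
    (hbound : ∀ x t, 0 ≤ t →
      μ • ContinuousLinearMap.id ℝ (EuclideanSpace ℝ (Fin n)) ≤ M x t ∧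
      M x t ≤ L • ContinuousLinearMap.id ℝ (EuclideanSpace ℝ (Fin n)))
    (hcontr : IsContracting f M lam) (hκ0 : 0 ≤ κ) (hκ : κ < lam) (hs : 0 ≤ s) (hsT : s ≤ T)
    {z : ℝ → EuclideanSpace ℝ (Fin n)} (hz : IsSolution f s T z)
    (p : EuclideanSpace ℝ (Fin n)) :
    ∃ w, w s = p ∧ IsSolution f s T w ∧ ∀ t ∈ Icc s T,
      ‖w t - z t‖ ≤ Real.sqrt (L / μ) * Real.exp (-κ * (t - s)) * ‖p - z s‖ := by
  set K := Real.sqrt (L / μ)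
  set d := ‖p - z s‖ with hd
  have hK0 : 0 ≤ K := Real.sqrt_nonneg _
  obtain ⟨R₀, hR₀⟩ := isCompact_Icc.exists_bound_of_continuousOn hz.continuousOn
  -- All solutions through the segment stay in the ball of radius `R`.
  set R := R₀ + K * d with hR
  obtain ⟨δ, hδ, hloc⟩ := exists_local_contraction hμ hμL hf hM hbound hcontr hκ R T
  obtain ⟨F, hF, hFf, C, hC0, hC⟩ := hf.exists_bounded_truncation (R + 1) T
  have hT : 0 ≤ T := hs.trans hsT
  have hsol : ∀ v : ℝ → EuclideanSpace ℝ (Fin n), (∀ t ∈ Icc s T, ‖v t‖ ≤ R + 1) →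
      (IsSolution F s T v ↔ IsSolution f s T v) := fun v hv =>
    forall₂_congr fun t ht => by rw [hFf (v t) (mem_closedBall_zero_iff.2 (hv t ht)) t]
  have hd0 : 0 ≤ d := norm_nonneg _
  have hR0 : 0 ≤ R := (add_nonneg ((norm_nonneg _).trans (hR₀ s (left_mem_Icc.2 hsT)))
    (by positivity))
  -- Solutions of the truncated field that start in the ball of radius `R + 1` never leave the ball
  -- of radius `ρ`.
  set ρ := (R + 1) + C * T with hρ
  obtain ⟨Λ, hΛ⟩ := hF.exists_lipschitzOnWith ρ T
  have hρbound : ∀ v : ℝ → EuclideanSpace ℝ (Fin n), ‖v s‖ ≤ R + 1 → IsSolution F s T v →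
      ∀ t ∈ Icc s T, ‖v t‖ ≤ ρ := by
    intro v hv0 hv t ht
    have h1 : ‖v t - v s‖ ≤ C * (t - s) :=
      norm_image_sub_le_of_norm_deriv_le_segment' hv
        (fun r hr => hC r ⟨hs.trans hr.1, hr.2.le⟩ _) t ht
    have h2 : C * (t - s) ≤ C * T := by gcongr; linarith [ht.2]
    linarith [norm_le_norm_add_norm_sub' (v t) (v s)]
  set η := min δ 1 with hη
  have hη0 : 0 < η := by positivity
  have hη1 : η ≤ 1 := min_le_right _ _
  set h := η * Real.exp (-(Λ * T)) / (d + 1) with hh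
  have hhpos : 0 < h := by positivity
  have hexp1 : ∀ t ∈ Icc s T, Real.exp (-κ * (t - s)) ≤ 1 := fun t ht =>
    Real.exp_le_one_iff.2 (by nlinarith [ht.1])
  suffices H : ∃ w, w s = z s + (1 : ℝ) • (p - z s) ∧ IsSolution f s T w ∧ ∀ t ∈ Icc s T,
      ‖w t - z t‖ ≤ K * Real.exp (-κ * (t - s)) * (1 * d) by
    obtain ⟨w, h1, h2, h3⟩ := H
    exact ⟨w, by simpa using h1, h2, by simpa using h3⟩
  refine induction_small_steps (P := fun θ : ℝ => ∃ w, w s = z s + θ • (p - z s) ∧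
      IsSolution f s T w ∧ ∀ t ∈ Icc s T, ‖w t - z t‖ ≤ K * Real.exp (-κ * (t - s)) * (θ * d))
    zero_le_one hhpos ⟨z, by simp, hz, by simp⟩ ?_
  rintro a b ha hab hb hba ⟨v, hvs, hv, hvz⟩
  have hvR : ∀ t ∈ Icc s T, ‖v t‖ ≤ R := by
    intro t ht
    have h1 : K * Real.exp (-κ * (t - s)) * (a * d) ≤ K * 1 * (1 * d) := by
      have := hexp1 t ht
      gcongr; linarith
    have h2 := hvz t ht
    have h3 := hR₀ t ht
    linarith [norm_le_norm_add_norm_sub' (v t) (z t)]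
  have hvF : IsSolution F s T v := (hsol v fun t ht => (hvR t ht).trans (by linarith)).2 hv
  obtain ⟨w, hws, hwF⟩ := exists_isSolution_of_bounded hF hC0 hC hs hsT (z s + b • (p - z s))
  have hdiff : ‖w s - v s‖ = (b - a) * d := by
    rw [hws, hvs, show z s + b • (p - z s) - (z s + a • (p - z s)) = (b - a) • (p - z s) by module,
      norm_smul, Real.norm_of_nonneg (by linarith)]
  have hsmall : ‖w s - v s‖ ≤ η * Real.exp (-(Λ * T)) := by
    rw [hdiff]
    calc (b - a) * d ≤ h * (d + 1) := by gcongr; linarith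
      _ = _ := by rw [hh]; field_simp
  have hsmall1 : ‖w s - v s‖ ≤ 1 := hsmall.trans <| by
    have : Real.exp (-(Λ * T)) ≤ 1 := Real.exp_le_one_iff.2 (by
      have : (0 : ℝ) ≤ Λ * T := by positivity
      linarith)
    calc _ ≤ (1 : ℝ) * 1 := by gcongr
      _ = 1 := one_mul 1
  have hws1 : ‖w s‖ ≤ R + 1 := by
    linarith [norm_le_norm_add_norm_sub' (w s) (v s), hvR s (left_mem_Icc.2 hsT)]
  have hclose : ∀ t ∈ Icc s T, ‖w t - v t‖ ≤ η := by
    intro t ht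
    have h1 := hvF.norm_sub_le hs hΛ hwF
      (fun t ht => (hvR t ht).trans (by rw [hρ]; nlinarith)) (hρbound w hws1 hwF) t ht
    calc _ ≤ _ := h1
      _ ≤ (η * Real.exp (-(Λ * T))) * Real.exp (Λ * T) := by
        gcongr; linarith [ht.2]
      _ = η := by rw [mul_assoc, ← Real.exp_add]; simp
  have hw : IsSolution f s T w := (hsol w fun t ht => by
    linarith [norm_le_norm_add_norm_sub' (w t) (v t), hvR t ht, hclose t ht]).1 hwF
  refine ⟨w, hws, hw, fun t ht => ?_⟩
  have h1 := hloc s hs v w hv hw hvR (fun t ht => (hclose t ht).trans (min_le_left _ _)) t ht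
  rw [hdiff] at h1
  have h2 := hvz t ht
  calc ‖w t - z t‖ ≤ ‖w t - v t‖ + ‖v t - z t‖ := norm_sub_le_norm_sub_add_norm_sub _ _ _
    _ ≤ _ := add_le_add h1 h2
    _ = _ := by ring

end Contraction

/-! ### Comparison with the perturbed trajectory -/

section Perturbation

variable {f : EuclideanSpace ℝ (Fin n) → ℝ → EuclideanSpace ℝ (Fin n)}
  {u y z : ℝ → EuclideanSpace ℝ (Fin n)} {a b T : ℝ}

lemma IsTrajectory.restrict (hy : IsTrajectory f u T y) {t : ℝ} (ht : t ∈ Icc 0 T) :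
    IsTrajectory f u t y := by
  have hsub : uIcc 0 t ⊆ uIcc 0 T := by
    rw [uIcc_of_le ht.1, uIcc_of_le (ht.1.trans ht.2)]
    exact Icc_subset_Icc_right ht.2
  exact ⟨hy.continuousOn.mono (Icc_subset_Icc_right ht.2), hy.input_integrable.mono_set hsub,
    hy.integrable.mono_set hsub, fun r hr => hy.eq_integral r ⟨hr.1, hr.2.trans ht.2⟩⟩

lemma IsTrajectory.eq_integral_add (hf : IsC1 f) (hy : IsTrajectory f u T y) (ha : 0 ≤ a)
    (hab : a ≤ b) (hb : b ≤ T) :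
    y b = y a + ((∫ r in a..b, f (y r) r) + ∫ r in a..b, u r) := by
  have hT : 0 ≤ T := ha.trans (hab.trans hb)
  have hsub : ∀ {c d : ℝ}, 0 ≤ c → c ≤ d → d ≤ T → uIcc c d ⊆ uIcc 0 T := fun h1 h2 h3 => by
    rw [uIcc_of_le h2, uIcc_of_le hT]
    exact Icc_subset_Icc h1 h3
  have hu := hy.input_integrable.mono_set (hsub ha hab hb)
  have hfy := ((continuousOn_comp_curve hf le_rfl hy.continuousOn).mono
    (Icc_subset_Icc ha hb)).intervalIntegrable_of_Icc (μ := volume) hab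
  rw [← intervalIntegral.integral_add hfy hu, hy.eq_integral b ⟨ha.trans hab, hb⟩,
    hy.eq_integral a ⟨ha, hab.trans hb⟩, add_assoc,
    intervalIntegral.integral_add_adjacent_intervals
      (hy.integrable.mono_set (hsub le_rfl ha (hab.trans hb)))
      (hy.integrable.mono_set (hsub ha hab hb))]

/-- Over a short time, the input moves a trajectory away from the unperturbed solution by little
more than its own integral. -/
lemma IsTrajectory.norm_sub_le (hf : IsC1 f) (hy : IsTrajectory f u T y) (ha : 0 ≤ a)
    (hab : a ≤ b) (hb : b ≤ T) (hz : IsSolution f a T z) (hza : z a = y a) {R h : ℝ} {Λ : NNReal}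
    (hΛ : ∀ t ∈ Icc 0 T, LipschitzOnWith Λ (fun z => f z t) (Metric.closedBall 0 R))
    (hyR : ∀ t ∈ Icc a b, ‖y t‖ ≤ R) (hzR : ∀ t ∈ Icc a b, ‖z t‖ ≤ R) (hbh : b - a ≤ h) :
    (1 - Λ * h) * ‖y b - z b‖ ≤ ∫ r in a..b, ‖u r‖ := by
  have hT : 0 ≤ T := ha.trans (hab.trans hb)
  have hyc : ContinuousOn y (Icc a b) := hy.continuousOn.mono (Icc_subset_Icc ha hb)
  have hzc : ContinuousOn z (Icc a b) := hz.continuousOn.mono (Icc_subset_Icc_right hb)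
  have hu : IntervalIntegrable u volume a b := hy.input_integrable.mono_set (by
    rw [uIcc_of_le hab, uIcc_of_le hT]; exact Icc_subset_Icc ha hb)
  -- The equation is applied at a time `c` where the deviation is largest.
  obtain ⟨c, hc, hmax⟩ := isCompact_Icc.exists_isMaxOn (nonempty_Icc.2 hab) (hyc.sub hzc).norm
  have hmax' : ∀ r ∈ Icc a b, ‖y r - z r‖ ≤ ‖y c - z c‖ := fun r hr => hmax hr
  have hsub : Icc a c ⊆ Icc a b := Icc_subset_Icc_right hc.2
  have hfy : IntervalIntegrable (fun r => f (y r) r) volume a c :=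
    ((continuousOn_comp_curve hf ha hyc).mono hsub).intervalIntegrable_of_Icc hc.1
  have hfz : IntervalIntegrable (fun r => f (z r) r) volume a c :=
    ((continuousOn_comp_curve hf ha hzc).mono hsub).intervalIntegrable_of_Icc hc.1
  have hdiff : y c - z c = (∫ r in a..c, (f (y r) r - f (z r) r)) + ∫ r in a..c, u r := by
    rw [hy.eq_integral_add hf ha hc.1 (hc.2.trans hb), hz.eq_integral hf ha ⟨hc.1, hc.2.trans hb⟩,
      hza, intervalIntegral.integral_sub hfy hfz]
    abel
  have h1 : ‖∫ r in a..c, (f (y r) r - f (z r) r)‖ ≤ Λ * ‖y c - z c‖ * |c - a| := by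
    refine intervalIntegral.norm_integral_le_of_norm_le_const fun r hr => ?_
    rw [uIoc_of_le hc.1] at hr
    have hr' : r ∈ Icc a b := ⟨hr.1.le, hr.2.trans hc.2⟩
    have := (hΛ r ⟨ha.trans hr'.1, hr'.2.trans hb⟩).norm_sub_le
      (mem_closedBall_zero_iff.2 (hyR r hr')) (mem_closedBall_zero_iff.2 (hzR r hr'))
    exact this.trans (by gcongr; exact hmax' r hr')
  have h2 : ‖∫ r in a..c, u r‖ ≤ ∫ r in a..b, ‖u r‖ :=
    (intervalIntegral.norm_integral_le_integral_norm hc.1).trans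
      (intervalIntegral.integral_mono_interval le_rfl hc.1 hc.2
        (Filter.Eventually.of_forall fun _ => norm_nonneg _) hu.norm)
  have h3 : ‖y c - z c‖ ≤ Λ * ‖y c - z c‖ * |c - a| + ∫ r in a..b, ‖u r‖ := by
    calc ‖y c - z c‖ = ‖(∫ r in a..c, (f (y r) r - f (z r) r)) + ∫ r in a..c, u r‖ := by
          rw [← hdiff]
      _ ≤ _ := (norm_add_le _ _).trans (add_le_add h1 h2)
  have h4 : Λ * ‖y c - z c‖ * |c - a| ≤ Λ * ‖y c - z c‖ * h := by
    rw [abs_of_nonneg (by linarith [hc.1])]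
    gcongr; linarith [hc.2]
  have h5 := hmax' b (right_mem_Icc.2 hab)
  have hU : 0 ≤ ∫ r in a..b, ‖u r‖ :=
    intervalIntegral.integral_nonneg hab fun _ _ => norm_nonneg _
  rcases le_total 0 (1 - Λ * h) with h6 | h6
  · calc _ ≤ (1 - Λ * h) * ‖y c - z c‖ := by gcongr
      _ ≤ _ := by linarith
  · exact (mul_nonpos_of_nonpos_of_nonneg h6 (norm_nonneg _)).trans hU

end Perturbation

/-! ### The stability estimate -/

section Stability

variable {f : EuclideanSpace ℝ (Fin n) → ℝ → EuclideanSpace ℝ (Fin n)}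
  {M : EuclideanSpace ℝ (Fin n) → ℝ →
      (EuclideanSpace ℝ (Fin n) →L[ℝ] EuclideanSpace ℝ (Fin n))} {μ L lam κ C T : ℝ}
  {u x y : ℝ → EuclideanSpace ℝ (Fin n)}

/-- The stability estimate up to a factor `C > 1` on the input and a loss `κ < lam` of rate, for
`t = T`. As `a` grows from `0` to `T`, the unperturbed solutions starting from `y a` at time `a` lead
from the solution with initial value `y 0` to the point `y T`. -/
lemma norm_sub_le_of_rate_lt (hμ : 0 < μ) (hμL : μ ≤ L)
    (hf : IsC1 f) (hM : IsC1 M)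
    (hbound : ∀ x t, 0 ≤ t →
      μ • ContinuousLinearMap.id ℝ (EuclideanSpace ℝ (Fin n)) ≤ M x t ∧
      M x t ≤ L • ContinuousLinearMap.id ℝ (EuclideanSpace ℝ (Fin n)))
    (hcontr : IsContracting f M lam) (hκ0 : 0 ≤ κ) (hκ : κ < lam) (hC : 1 < C) (hT : 0 ≤ T)
    (hx : IsTrajectory f 0 T x) (hy : IsTrajectory f u T y) :
    ‖x T - y T‖ ≤ Real.sqrt (L / μ) * Real.exp (-κ * T) *
      (‖x 0 - y 0‖ + C * ∫ r in (0 : ℝ)..T, Real.exp (κ * r) * ‖u r‖) := by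
  set K := Real.sqrt (L / μ)
  have hK0 : 0 ≤ K := Real.sqrt_nonneg _
  set D := ‖x 0 - y 0‖ with hD
  have hD0 : 0 ≤ D := norm_nonneg _
  set I : ℝ → ℝ := fun a => ∫ r in (0 : ℝ)..a, Real.exp (κ * r) * ‖u r‖ with hI
  have hxsol := hx.isSolution hf
  have hint : ∀ a b, 0 ≤ a → a ≤ b → b ≤ T →
      IntervalIntegrable u volume a b ∧
      IntervalIntegrable (fun r => Real.exp (κ * r) * ‖u r‖) volume a b := fun a b ha hab hb => by
    have hu : IntervalIntegrable u volume a b := hy.input_integrable.mono_set (by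
      rw [uIcc_of_le hab, uIcc_of_le hT]; exact Icc_subset_Icc ha hb)
    exact ⟨hu, hu.norm.continuousOn_mul (by fun_prop)⟩
  have hIsub : ∀ a b, 0 ≤ a → a ≤ b → b ≤ T →
      Real.exp (κ * a) * (∫ r in a..b, ‖u r‖) ≤ I b - I a := fun a b ha hab hb => by
    have h1 := (hint 0 a le_rfl ha (hab.trans hb)).2
    have h2 := (hint 0 b le_rfl (ha.trans hab) hb).2
    obtain ⟨h3, h4⟩ := hint a b ha hab hb
    rw [hI, intervalIntegral.integral_interval_sub_left h2 h1, ← intervalIntegral.integral_const_mul]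
    refine intervalIntegral.integral_mono_on hab (h3.norm.const_mul _) h4 fun r hr => ?_
    have := hr.1
    gcongr
  have hU0 : ∀ a b, a ≤ b → 0 ≤ ∫ r in a..b, ‖u r‖ := fun a b hab =>
    intervalIntegral.integral_nonneg hab fun _ _ => norm_nonneg _
  have hImono : ∀ a b, 0 ≤ a → a ≤ b → b ≤ T → I a ≤ I b := fun a b ha hab hb => by
    have := mul_nonneg (Real.exp_pos (κ * a)).le (hU0 a b hab)
    linarith [hIsub a b ha hab hb]
  have hI0 : I 0 = 0 := by simp [hI]
  have hC0 : 0 ≤ C := by linarith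
  -- All the solutions that occur lie in the ball of radius `R`.
  obtain ⟨Rx, hRx⟩ := isCompact_Icc.exists_bound_of_continuousOn hx.continuousOn
  obtain ⟨Ry, hRy⟩ := isCompact_Icc.exists_bound_of_continuousOn hy.continuousOn
  set R := max Ry (Rx + K * (D + C * I T)) with hR
  obtain ⟨Λ, hΛ⟩ := hf.exists_lipschitzOnWith R T
  -- The step length makes the error factor `exp (κ * h) / (1 - Λ * h)` of one step at most `C`.
  obtain ⟨h, hh0, hh⟩ : ∃ h > 0, Real.exp (κ * h) < C * (1 - Λ * h) := by
    have hc : Filter.Tendsto (fun h : ℝ => C * (1 - Λ * h) - Real.exp (κ * h))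
        (nhdsWithin 0 (Ioi 0)) (nhds (C * (1 - Λ * 0) - Real.exp (κ * 0))) :=
      (Continuous.tendsto (by fun_prop) 0).mono_left nhdsWithin_le_nhds
    have hpos : 0 < C * (1 - Λ * 0) - Real.exp (κ * 0) := by simpa using hC
    obtain ⟨h, h1, h2⟩ := ((hc.eventually (lt_mem_nhds hpos)).and self_mem_nhdsWithin).exists
    exact ⟨h, h2, by linarith⟩
  have hΛh : 0 < 1 - Λ * h := pos_of_mul_pos_right ((Real.exp_pos _).trans hh) hC0
  suffices H : ∃ z, z T = y T ∧ IsSolution f T T z ∧ ∀ t ∈ Icc T T,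
      ‖z t - x t‖ ≤ K * Real.exp (-κ * t) * (D + C * I T) by
    obtain ⟨z, h1, -, h2⟩ := H
    have := h2 T ⟨le_rfl, le_rfl⟩
    rwa [h1, norm_sub_rev] at this
  refine induction_small_steps (P := fun a => ∃ z, z a = y a ∧ IsSolution f a T z ∧
    ∀ t ∈ Icc a T, ‖z t - x t‖ ≤ K * Real.exp (-κ * t) * (D + C * I a)) hT hh0 ?_ ?_
  · obtain ⟨z, h1, h2, h3⟩ := exists_isSolution_contracting hμ hμL hf hM hbound hcontr hκ0 hκ
      le_rfl hT hxsol (y 0)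
    refine ⟨z, h1, h2, fun t ht => ?_⟩
    simpa [hI0, hD, norm_sub_rev (x 0)] using h3 t ht
  rintro a b ha hab hb hba ⟨z, hza, hz, hzx⟩
  have hzR : ∀ t ∈ Icc a T, ‖z t‖ ≤ R := by
    intro t ht
    have ht0 := ha.trans ht.1
    have h1 : Real.exp (-κ * t) ≤ 1 := Real.exp_le_one_iff.2 (by nlinarith)
    have h2 : 0 ≤ I a := hI0 ▸ hImono 0 a le_rfl ha (hab.trans hb)
    have h3 : K * Real.exp (-κ * t) * (D + C * I a) ≤ K * 1 * (D + C * I T) := by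
      have := hImono a T ha (hab.trans hb) le_rfl
      gcongr
    have h4 := hzx t ht
    have h5 := hRx t ⟨ht0, ht.2⟩
    refine le_max_of_le_right ?_
    linarith [norm_le_norm_add_norm_sub' (z t) (x t)]
  have hyz := hy.norm_sub_le hf ha hab hb hz hza hΛ
    (fun t ht => (hRy t ⟨ha.trans ht.1, ht.2.trans hb⟩).trans (le_max_left _ _))
    (fun t ht => hzR t ⟨ht.1, ht.2.trans hb⟩) hba
  obtain ⟨w, hwb, hw, hwz⟩ := exists_isSolution_contracting hμ hμL hf hM hbound hcontr hκ0 hκ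
      (ha.trans hab) hb (hz.mono hab) (y b)
  refine ⟨w, hwb, hw, fun t ht => ?_⟩
  have hstep : Real.exp (κ * b) * ‖y b - z b‖ ≤ C * (I b - I a) := by
    refine le_of_mul_le_mul_left ?_ hΛh
    calc (1 - Λ * h) * (Real.exp (κ * b) * ‖y b - z b‖)
        = Real.exp (κ * b) * ((1 - Λ * h) * ‖y b - z b‖) := by ring
      _ ≤ Real.exp (κ * h + κ * a) * ∫ r in a..b, ‖u r‖ := by
        gcongr; nlinarith
      _ = Real.exp (κ * h) * (Real.exp (κ * a) * ∫ r in a..b, ‖u r‖) := by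
        rw [Real.exp_add, mul_assoc]
      _ ≤ (C * (1 - Λ * h)) * (I b - I a) := by
        have := hU0 a b hab
        gcongr
        exact hIsub a b ha hab hb
      _ = _ := by ring
  have hexp : Real.exp (-κ * (t - b)) = Real.exp (-κ * t) * Real.exp (κ * b) := by
    rw [← Real.exp_add]; congr 1; ring
  calc ‖w t - x t‖ ≤ ‖w t - z t‖ + ‖z t - x t‖ := norm_sub_le_norm_sub_add_norm_sub _ _ _
    _ ≤ K * Real.exp (-κ * (t - b)) * ‖y b - z b‖ +
        K * Real.exp (-κ * t) * (D + C * I a) :=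
      add_le_add (hwz t ht) (hzx t ⟨hab.trans ht.1, ht.2⟩)
    _ = K * Real.exp (-κ * t) * (Real.exp (κ * b) * ‖y b - z b‖) +
        K * Real.exp (-κ * t) * (D + C * I a) := by rw [hexp]; ring
    _ ≤ K * Real.exp (-κ * t) * (C * (I b - I a)) +
        K * Real.exp (-κ * t) * (D + C * I a) := by gcongr
    _ = _ := by ring

end Stability

end ContractionISS

theorem mainTheorem2 {n : ℕ}
    (f : EuclideanSpace ℝ (Fin n) → ℝ → EuclideanSpace ℝ (Fin n))
    (M : EuclideanSpace ℝ (Fin n) → ℝ →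
      (EuclideanSpace ℝ (Fin n) →L[ℝ] EuclideanSpace ℝ (Fin n)))
    (μ L lam : ℝ) (hμ : 0 < μ) (hμL : μ ≤ L) (hlam : 0 < lam)
    (hf : ContractionISS.IsC1 f)
    (hM : ContractionISS.IsRiemannianMetric M)
    (hbound : ∀ x t, 0 ≤ t →
      μ • ContinuousLinearMap.id ℝ (EuclideanSpace ℝ (Fin n)) ≤ M x t ∧
      M x t ≤ L • ContinuousLinearMap.id ℝ (EuclideanSpace ℝ (Fin n)))
    (hcontr : ContractionISS.IsContracting f M lam) :
    ContractionISS.IsEdISS (Real.sqrt (L / μ)) lam (Real.sqrt (L / μ)) f := by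
  have hK : 0 < Real.sqrt (L / μ) := Real.sqrt_pos.2 (div_pos (hμ.trans_le hμL) hμ)
  refine ⟨hK, hlam, hK, fun T u x y hx' hy' t ht => ?_⟩
  have hx := hx'.restrict ht
  have hy := hy'.restrict ht
  have hu := hy.input_integrable
  have hint : ∀ κ : ℝ,
      IntervalIntegrable (fun r => Real.exp (κ * r) * ‖u r‖) volume 0 t := fun κ =>
    hu.norm.continuousOn_mul (by fun_prop)
  set J := ∫ r in (0 : ℝ)..t, Real.exp (lam * r) * ‖u r‖ with hJ
  have hloss : ∀ ε ∈ Ioo 0 lam, ‖x t - y t‖ ≤ Real.sqrt (L / μ) * Real.exp (-(lam - ε) * t) *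
      (‖x 0 - y 0‖ + (1 + ε) * J) := by
    intro ε hε
    refine (ContractionISS.norm_sub_le_of_rate_lt hμ hμL hf hM.contDiff hbound hcontr
      (κ := lam - ε) (C := 1 + ε) (by linarith [hε.2]) (by linarith [hε.1]) (by linarith [hε.1])
      ht.1 hx hy).trans ?_
    have hε0 := hε.1.le
    have : ∫ r in (0 : ℝ)..t, Real.exp ((lam - ε) * r) * ‖u r‖ ≤ J :=
      intervalIntegral.integral_mono_on ht.1 (hint _) (hint _) fun r hr => by
        have := hr.1
        gcongr
        linarith
    gcongr
  -- The loss `ε` of rate is sent to zero.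
  have hlim : ‖x t - y t‖ ≤ Real.sqrt (L / μ) * Real.exp (-(lam - 0) * t) *
      (‖x 0 - y 0‖ + (1 + 0) * J) := by
    have hc : Filter.Tendsto (fun ε : ℝ => Real.sqrt (L / μ) * Real.exp (-(lam - ε) * t) *
        (‖x 0 - y 0‖ + (1 + ε) * J)) (nhdsWithin 0 (Ioi 0)) (nhds _) :=
      (Continuous.tendsto (by fun_prop) 0).mono_left nhdsWithin_le_nhds
    exact ge_of_tendsto hc (Filter.mem_of_superset (Ioo_mem_nhdsGT hlam) hloss)
  have hfactor : ∫ s in (0 : ℝ)..t, Real.exp (-lam * (t - s)) * ‖u s‖ =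
      Real.exp (-lam * t) * J := by
    rw [hJ, ← intervalIntegral.integral_const_mul]
    congr 1 with s
    rw [← mul_assoc, ← Real.exp_add]
    ring_nf
  rw [hfactor]
  refine hlim.trans_eq ?_
  rw [sub_zero, add_zero]
  ring
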